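/- Let $K$ be an algebraically closed field of characteristic zero, let $I\subseteq K[x_1,\dots,x_n]$ be an ideal generated by monomials such that $A=K[x_1,\dots,x_n]/I$ is a finite-dimensional local algebra, let $\mathfrak m$ be its maximal ideal, and let $U\subseteq A$ be the subspace spanned by the classes of $x_1,\dots,x_n$. Then $U\subseteq\mathfrak m$ and $U$ generates $A$ as a unital $K$-algebra. Let $\pi:A\setminus\{0\}\to\mathbb P(A)$ be the canonical projection and let $X=\overline{\pi(\exp(U)\cdot 1)}\subseteq\mathbb P(A)$ (Zariski closure), where $\exp(u)=\sum_{k\ge 0}u^k/k!$. Then the following hold. 1. The vector group $(U,+)$, with $u\in U$ acting on $\mathbb P(A)$ through multiplication by $\exp(u)$, acts regularly and effectively on $\mathbb P(A)$, and $X$ is the closure of one of its orbits. This action restricts to a regular effective action on $X$ with an open orbit (the induced additive action corresponding to $(A,U)$). 2. The linear action of the torus $\mathbb G_m^n=(K^\times)^n$ on $A$ given by $(t_1,\dots,t_n)\circ x_1^{i_1}\cdots x_n^{i_n}=t_1^{i_1}\cdots t_n^{i_n}\,x_1^{i_1}\cdots x_n^{i_n}$ is well defined, and the action it induces on $\mathbb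 P(A)$ restricts to a regular action of $\mathbb G_m^n$ on $X$ with an open orbit. If no variable $x_i$ lies in $I$ (so that $U=Kx_1\oplus\dots\oplus Kx_n$ is $n$-dimensional), this torus action on $X$ is effective. 3. The additive action is normalized by this torus: the image of $\mathbb G_m^n$ in the group of automorphisms of $X$ normalizes the image of $(U,+)$. -/

import Mathlib

open scoped LinearAlgebra.Projectivization

noncomputable section

namespace SPair

/-! ### Polynomial functions, the Zariski topology on a projective space, regular maps

The ground field `K` is algebraically closed wherever these notions are used, so varieties are
sets of `K`-points and regular functions are honest functions. -/

section Geometry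

variable (K : Type*) [Field K]

/-- The `K`-algebra of polynomial functions on a vector space `V`. -/
def polyFun (V : Type*) [AddCommGroup V] [Module K V] : Subalgebra K (V → K) :=
  Algebra.adjoin K {f | ∃ φ : Module.Dual K V, f = fun v => φ v}

/-- The Zariski topology on `ℙ K V`: a basis is formed by the sets where a homogeneous polynomial
function does not vanish. -/
instance zariskiTopology (V : Type*) [AddCommGroup V] [Module K V] : TopologicalSpace (ℙ K V) :=
  TopologicalSpace.generateFrom
    {O | ∃ f ∈ polyFun K V, ∃ d : ℕ, (∀ (c : K) (v : V), f (c • v) = c ^ d * f v) ∧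
      O = {x : ℙ K V | f x.rep ≠ 0}}

variable {K}

/-- Functions on `Y × V` which are polynomial along `V` with coefficients in a given algebra `R`
of functions on `Y`. -/
def polyFunOver {Y : Type*} (R : Subalgebra K (Y → K))
    (V : Type*) [AddCommGroup V] [Module K V] : Subalgebra K (Y × V → K) :=
  Algebra.adjoin K
    ({f | ∃ r ∈ R, f = fun p => r p.1} ∪ {f | ∃ φ : Module.Dual K V, f = fun p => φ p.2})

/-- Let `Y` be an affine variety with algebra of regular functions `R`, and let `X ⊆ ℙ K V` be a
closed subset. The map `f : Y × X → ℙ K W` is a morphism if near every point it is given by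
a `W`-valued function whose coordinates are polynomial on `V`, homogeneous of one degree, with
coefficients in `R`. (A regular function on a smaller neighbourhood of a point contains a basic
open neighbourhood, and multiplying by its equation makes the formula valid wherever the
resulting representative is nonzero.) -/
def IsRegularMap {Y : Type*} (R : Subalgebra K (Y → K))
    {V : Type*} [AddCommGroup V] [Module K V] {W : Type*} [AddCommGroup W] [Module K W]
    (X : Set (ℙ K V)) (f : Y → X → ℙ K W) : Prop :=
  ∀ (y₀ : Y) (x₀ : X), ∃ (d : ℕ) (F : Y → V → W),
    (∀ φ : Module.Dual K W, (fun p : Y × V => φ (F p.1 p.2)) ∈ polyFunOver R V) ∧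
    (∀ (y : Y) (c : K) (v : V), F y (c • v) = c ^ d • F y v) ∧
    F y₀ (x₀ : ℙ K V).rep ≠ 0 ∧
    ∀ (y : Y) (x : X) (h : F y (x : ℙ K V).rep ≠ 0),
      f y x = Projectivization.mk K (F y (x : ℙ K V).rep) h

/-- The algebra of regular functions on the vector group `(U, +)`, which is a `𝔾ₐ^m` for
`m = dim U`. -/
def vectorGroupFun (K : Type*) [Field K] (U : Type*) [AddCommGroup U] [Module K U] :
    Subalgebra K (Multiplicative U → K) :=
  Algebra.adjoin K {f | ∃ φ : Module.Dual K U, f = fun u => φ u.toAdd}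

/-- The algebra of regular functions (Laurent polynomials) on the torus `𝔾ₘ^n`. -/
def torusFun (K : Type*) [Field K] (n : ℕ) : Subalgebra K ((Fin n → Kˣ) → K) :=
  Algebra.adjoin K
    ({f | ∃ i : Fin n, f = fun t => (t i : K)} ∪ {f | ∃ i : Fin n, f = fun t => (t i : K)⁻¹})

section Actions

variable {G : Type*} [Group G] {V : Type*} [AddCommGroup V] [Module K V]

/-- The action on `ℙ K V` induced by a linear representation on `V`. -/
def projAction (ρ : G →* (V ≃ₗ[K] V)) : G →* Equiv.Perm (ℙ K V) :=
  (MulAction.toPermHom (V ≃ₗ[K] V) (ℙ K V)).comp ρ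

/-- The action `a` on `X` is the restriction of the action `α` on the ambient projective space
(in particular `X` is invariant under `α`). -/
def IsRestriction (α : G →* Equiv.Perm (ℙ K V)) (X : Set (ℙ K V)) (a : G →* Equiv.Perm X) : Prop :=
  ∀ (g : G) (x : X), (a g x : ℙ K V) = α g (x : ℙ K V)

/-- The group `G`, with algebra of regular functions `R`, acts on `X` regularly, i.e. the action
map `G × X → X` is a morphism. -/
def IsRegularAction (R : Subalgebra K (G → K)) (X : Set (ℙ K V)) (a : G →* Equiv.Perm X) : Prop :=
  IsRegularMap R X (fun g x => (a g x : ℙ K V))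

/-- Some orbit is open in the Zariski topology of `X`. -/
def HasOpenOrbit (X : Set (ℙ K V)) (a : G →* Equiv.Perm X) : Prop :=
  ∃ x : X, IsOpen (Set.range fun g => a g x)

/-- An additive action on `X`: a regular effective action of the vector group `(U, +)` with an
open orbit. -/
structure IsAdditiveAction {U : Type*} [AddCommGroup U] [Module K U]
    (X : Set (ℙ K V)) (a : Multiplicative U →* Equiv.Perm X) : Prop where
  regular : IsRegularAction (vectorGroupFun K U) X a
  effective : Function.Injective a
  openOrbit : HasOpenOrbit X a

/-- An induced additive action on `X ⊆ ℙ K V`: a regular effective action of the vector group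
`(U, +)` on `ℙ K V` such that `X` is the closure of an orbit. -/
structure IsInducedAdditiveAction {U : Type*} [AddCommGroup U] [Module K U]
    (α : Multiplicative U →* Equiv.Perm (ℙ K V)) (X : Set (ℙ K V)) : Prop where
  regular : IsRegularMap (vectorGroupFun K U) Set.univ
    (fun u (x : (Set.univ : Set (ℙ K V))) => α u (x : ℙ K V))
  effective : Function.Injective α
  orbitClosure : ∃ x : ℙ K V, X = closure (Set.range fun u => α u x)

end Actions

end Geometry

/-! ### Pairs `(A, U)` and their varieties -/

section Pairs

variable {K : Type*} [Field K] {A : Type*} [CommRing A] [Algebra K A]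

/-- `(A, U)` is an `S`-pair: `A` is local and `U` is a subspace of its maximal ideal generating
`A` as a unital algebra. -/
structure IsSPair (U : Submodule K A) : Prop where
  isLocalRing : IsLocalRing A
  le_maximalIdeal : ∀ u ∈ U, u ∈ IsLocalRing.maximalIdeal A
  adjoin_eq_top : Algebra.adjoin K (U : Set A) = ⊤

/-- The closure of `π(exp(U) · 1)` in `ℙ(A)`. -/
def expVariety [Module ℚ A] (U : Submodule K A) : Set (ℙ K A) :=
  closure {p | ∃ u ∈ U, ∃ h : IsNilpotent.exp u ≠ 0, p = Projectivization.mk K _ h}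

end Pairs

/-! ### Monomial algebras -/

section Monomial

variable {K : Type*} [Field K] {n : ℕ}

/-- The ideal `I` is generated by monomials. -/
def IsMonomialIdeal (I : Ideal (MvPolynomial (Fin n) K)) : Prop :=
  ∃ S : Set (Fin n →₀ ℕ), I = Ideal.span ((fun m => MvPolynomial.monomial m (1 : K)) '' S)

/-- The subspace of `K[x₁, …, xₙ] / I` spanned by the classes of the variables. -/
def variableSpan (I : Ideal (MvPolynomial (Fin n) K)) :
    Submodule K (MvPolynomial (Fin n) K ⧸ I) :=
  Submodule.span K (Set.range fun i => Ideal.Quotient.mk I (MvPolynomial.X i))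

end Monomial

end SPair

end

/-!
The orbit of the line through `1` under `exp U` is, by definition, dense in the variety `X` of the
pair. Everything rests on describing this orbit inside the affine chart where the constant term
`e` does not vanish. In a monomial algebra, the constant term and the linear coefficients are well
defined functionals, and the linear part `p : A → U` satisfies `p (exp u) = u`, because the term
`u ^ k / k!` of the exponential series is homogeneous of degree `k`. Hence a vector `v` with
`e v ≠ 0` spans a line of the orbit exactly when `v / e v = exp (p v / e v)`. Since `U` consists of
nilpotent elements, clearing denominators gives homogeneous polynomial equations; they pass to the
closure, so the orbit is the intersection of `X` with the open set `e ≠ 0`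
(`exists_exp_of_mem_expVariety`). This gives the open orbit of the additive action, and the
identity `p (exp u) = u` gives effectiveness.

The torus acts on the algebra by algebra automorphisms `scaleHom` preserving `U`, so that
`t ∘ exp u = exp (t ∘ u)`. Therefore it preserves `X` and normalizes the additive action
(`torusAction_range_le_normalizer`). The orbit of `exp (x₁ + ⋯ + xₙ)` consists of the points
`exp (∑ aᵢ xᵢ)` with `aᵢ ≠ 0` whenever `xᵢ ∉ I`, and is cut out in `X` by the nonvanishing of the
constant term and of these linear coefficients (`hasOpenOrbit_torusAction`); the coefficients also
recover `t` (`torusAction_injective`). Both actions are regular because they come from linear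
representations with regular matrix coefficients (`isRegularMap_projAction`).
-/

noncomputable section

namespace SPair

/-! ### Vector-valued maps with regular coordinates -/

section Coordinates

variable {K : Type*} [Field K] {Z : Type*} {W : Type*} [AddCommGroup W] [Module K W]

/-- A `W`-valued map all of whose coordinates lie in a given algebra `S` of functions. Coordinates
are taken with respect to all linear functionals, so that no basis of `W` is chosen. -/
def HasCoordsIn (S : Subalgebra K (Z → K)) (F : Z → W) : Prop :=
  ∀ φ : Module.Dual K W, (fun z => φ (F z)) ∈ S

namespace HasCoordsIn

variable {S : Subalgebra K (Z → K)} {F G : Z → W}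

lemma const (w : W) : HasCoordsIn S (fun _ => w) := fun φ => S.algebraMap_mem (φ w)

lemma sub (hF : HasCoordsIn S F) (hG : HasCoordsIn S G) : HasCoordsIn S (fun z => F z - G z) := by
  intro φ
  simp only [map_sub]
  exact S.sub_mem (hF φ) (hG φ)

lemma smul {r : Z → K} (hr : r ∈ S) (hF : HasCoordsIn S F) :
    HasCoordsIn S (fun z => r z • F z) := by
  intro φ
  simp only [map_smul]
  exact S.mul_mem hr (hF φ)

lemma const_smul (c : K) (hF : HasCoordsIn S F) : HasCoordsIn S (fun z => c • F z) :=
  smul (S.algebraMap_mem c) hF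

lemma sum {ι : Type*} {s : Finset ι} {F : ι → Z → W} (hF : ∀ i ∈ s, HasCoordsIn S (F i)) :
    HasCoordsIn S (fun z => ∑ i ∈ s, F i z) := by
  intro φ
  have h := S.sum_mem fun i hi => hF i hi φ
  convert h using 1
  ext z
  simp

lemma map {W' : Type*} [AddCommGroup W'] [Module K W'] (L : W →ₗ[K] W')
    (hF : HasCoordsIn S F) : HasCoordsIn S (fun z => L (F z)) :=
  fun φ => hF (φ ∘ₗ L)

variable {A : Type*} [CommRing A] [Algebra K A] [FiniteDimensional K A] {P Q : Z → A}

lemma mul (hP : HasCoordsIn S P) (hQ : HasCoordsIn S Q) : HasCoordsIn S (fun z => P z * Q z) := by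
  let b := Module.finBasis K A
  have h : (fun z => P z * Q z) =
      fun z => ∑ i, b.coord i (P z) • LinearMap.mulLeft K (b i) (Q z) := by
    ext z
    conv_lhs => rw [← b.sum_repr (P z), Finset.sum_mul]
    simp only [smul_mul_assoc, Module.Basis.coord_apply, LinearMap.mulLeft_apply]
  rw [h]
  exact sum fun i _ => smul (hP _) (hQ.map _)

lemma pow (hP : HasCoordsIn S P) (k : ℕ) : HasCoordsIn S (fun z => P z ^ k) := by
  induction k with
  | zero => simpa using const (S := S) (1 : A)
  | succ k ih => simpa only [pow_succ] using ih.mul hP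

lemma exp [CharZero K] [Module ℚ A] (hP : HasCoordsIn S P) {N : ℕ} (hN : ∀ z, P z ^ N = 0) :
    HasCoordsIn S (fun z => IsNilpotent.exp (P z)) := by
  have h : (fun z => IsNilpotent.exp (P z)) =
      fun z => ∑ k ∈ Finset.range N, (((k.factorial : ℚ)⁻¹ : ℚ) : K) • P z ^ k := by
    ext z
    simp only [IsNilpotent.exp_eq_sum (hN z), Rat.cast_smul_eq_qsmul]
  rw [h]
  exact sum fun k _ => (hP.pow k).const_smul _

end HasCoordsIn

end Coordinates

/-! ### Zariski-open sets and linear actions -/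

section Projective

variable {K : Type*} [Field K] {V : Type*} [AddCommGroup V] [Module K V]

lemma comp_linearMap_mem_polyFun {f : V → K} (hf : f ∈ polyFun K V) (L : V →ₗ[K] V) :
    (fun v => f (L v)) ∈ polyFun K V := by
  induction hf using Algebra.adjoin_induction with
  | mem f hf =>
    obtain ⟨φ, rfl⟩ := hf
    exact Algebra.subset_adjoin ⟨φ ∘ₗ L, rfl⟩
  | algebraMap c => exact (polyFun K V).algebraMap_mem c
  | add f g _ _ hf hg => exact (polyFun K V).add_mem hf hg
  | mul f g _ _ hf hg => exact (polyFun K V).mul_mem hf hg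

lemma isOpen_setOf_ne_zero {f : V → K} (hf : f ∈ polyFun K V) (d : ℕ)
    (hd : ∀ (c : K) (v : V), f (c • v) = c ^ d * f v) : IsOpen {x : ℙ K V | f x.rep ≠ 0} :=
  TopologicalSpace.isOpen_generateFrom_of_mem ⟨f, hf, d, hd, rfl⟩

lemma isOpen_setOf_dual_ne_zero (φ : Module.Dual K V) : IsOpen {x : ℙ K V | φ x.rep ≠ 0} :=
  isOpen_setOf_ne_zero (f := fun v => φ v) (Algebra.subset_adjoin ⟨φ, rfl⟩) 1 (by simp)

lemma rep_mk_ne_zero_iff {f : V → K} {d : ℕ} (hd : ∀ (c : K) (v : V), f (c • v) = c ^ d * f v)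
    {v : V} (hv : v ≠ 0) : f (Projectivization.mk K v hv).rep ≠ 0 ↔ f v ≠ 0 := by
  obtain ⟨a, ha⟩ := Projectivization.exists_smul_eq_mk_rep K v hv
  rw [← ha, Units.smul_def, hd]
  simp

lemma dual_rep_mk_ne_zero_iff (φ : Module.Dual K V) {v : V} (hv : v ≠ 0) :
    φ (Projectivization.mk K v hv).rep ≠ 0 ↔ φ v ≠ 0 :=
  rep_mk_ne_zero_iff (f := fun v => φ v) (d := 1) (by simp) hv

lemma mk_congr {v w : V} (h : v = w) (hv : v ≠ 0) (hw : w ≠ 0) :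
    Projectivization.mk K v hv = Projectivization.mk K w hw := by
  subst h
  rfl

/-- Two vectors on which a functional takes the value `1` are equal as soon as they span the same
line. -/
lemma eq_of_mk_eq_mk {φ : Module.Dual K V} {v w : V} {hv : v ≠ 0} {hw : w ≠ 0}
    (h : Projectivization.mk K v hv = Projectivization.mk K w hw) (h1 : φ v = 1) (h2 : φ w = 1) :
    v = w := by
  obtain ⟨c, rfl⟩ := (Projectivization.mk_eq_mk_iff' K v w hv hw).1 h
  have hc : c = 1 := by simpa [h2] using h1
  rw [hc, one_smul]

variable {G : Type*} [Group G]

lemma projAction_mk (ρ : G →* (V ≃ₗ[K] V)) (g : G) {v : V} (hv : v ≠ 0) :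
    projAction ρ g (Projectivization.mk K v hv) =
      Projectivization.mk K (ρ g v) ((ρ g).map_ne_zero_iff.2 hv) :=
  rfl

lemma continuous_projAction (ρ : G →* (V ≃ₗ[K] V)) (g : G) : Continuous (projAction ρ g) := by
  refine continuous_generateFrom_iff.2 ?_
  rintro _ ⟨f, hf, d, hd, rfl⟩
  have hd' : ∀ (c : K) (v : V), f (ρ g (c • v)) = c ^ d * f (ρ g v) := by
    intro c v
    rw [map_smul, hd]
  convert isOpen_setOf_ne_zero (comp_linearMap_mem_polyFun hf (ρ g : V →ₗ[K] V)) d hd' using 1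
  ext x
  induction x using Projectivization.ind with
  | h v hv =>
    rw [Set.mem_preimage, projAction_mk, Set.mem_ofPred_eq, Set.mem_ofPred_eq,
      rep_mk_ne_zero_iff hd,
      rep_mk_ne_zero_iff (f := fun v => f ((ρ g : V →ₗ[K] V) v)) hd' hv]
    rfl

/-- The restriction of a group action to an invariant subset. -/
def restrictAction {P : Type*} (α : G →* Equiv.Perm P) (X : Set P)
    (hX : ∀ g, ∀ x ∈ X, α g x ∈ X) : G →* Equiv.Perm X where
  toFun g := (α g).subtypePerm fun x =>
    ⟨fun h => by simpa [← Equiv.Perm.mul_apply, ← map_mul] using hX g⁻¹ _ h, hX g x⟩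
  map_one' := by
    ext x
    simp
  map_mul' g h := by
    ext x
    exact congrArg (fun f : Equiv.Perm P => f x) (map_mul α g h)

/-- A linear representation with regular matrix coefficients induces a morphism on the projective
space; a single formula, linear in the vector, represents it everywhere. -/
lemma isRegularMap_projAction {R : Subalgebra K (G → K)} {ρ : G →* (V ≃ₗ[K] V)}
    (hρ : HasCoordsIn (polyFunOver R V) fun p : G × V => ρ p.1 p.2) (X : Set (ℙ K V)) :
    IsRegularMap R X fun g x => projAction ρ g x := by
  intro g₀ x₀
  refine ⟨1, fun g v => ρ g v, hρ, by simp, ?_, ?_⟩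
  · exact (ρ g₀).map_ne_zero_iff.2 x₀.1.rep_nonzero
  · intro g x h
    change projAction ρ g (x : ℙ K V) = _
    conv_lhs => rw [← (x : ℙ K V).mk_rep]
    exact projAction_mk ρ g _

/-- A multiplicative family of endomorphisms indexed by a group consists of automorphisms. -/
def representationOfEnd (θ : G →* Module.End K V) : G →* (V ≃ₗ[K] V) :=
  (LinearMap.GeneralLinearGroup.generalLinearEquiv K V).toMonoidHom.comp θ.toHomUnits

lemma snd_hasCoordsIn {Y : Type*} (R : Subalgebra K (Y → K)) :
    HasCoordsIn (polyFunOver R V) fun p : Y × V => p.2 :=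
  fun φ => Algebra.subset_adjoin (Or.inr ⟨φ, rfl⟩)

lemma fst_mem_polyFunOver {Y : Type*} {R : Subalgebra K (Y → K)} {r : Y → K} (hr : r ∈ R) :
    (fun p : Y × V => r p.1) ∈ polyFunOver R V :=
  Algebra.subset_adjoin (Or.inl ⟨r, hr, rfl⟩)

end Projective

/-! ### The orbit of the exponential map -/

section Exponential

variable {K : Type*} [Field K] {A : Type*} [CommRing A] [Algebra K A] [Module ℚ A]

lemma exp_ne_zero [Nontrivial A] {u : A} (hu : IsNilpotent u) : IsNilpotent.exp u ≠ 0 :=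
  (IsNilpotent.isUnit_exp hu).ne_zero

/-- The vector group `U` acts on `A` through multiplication by exponents. -/
def expRepresentation (U : Submodule K A) (hU : ∀ u ∈ U, IsNilpotent u) :
    Multiplicative U →* (A ≃ₗ[K] A) :=
  representationOfEnd
    { toFun := fun u => LinearMap.mulLeft K (IsNilpotent.exp (u.toAdd : A))
      map_one' := by
        ext
        simp [IsNilpotent.exp_zero]
      map_mul' := fun u v => by
        ext b
        simp [IsNilpotent.exp_add_of_commute (Commute.all _ _) (hU _ u.toAdd.2) (hU _ v.toAdd.2)] }

lemma expRepresentation_apply (U : Submodule K A) (hU : ∀ u ∈ U, IsNilpotent u)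
    (u : Multiplicative U) (b : A) :
    expRepresentation U hU u b = IsNilpotent.exp (u.toAdd : A) * b :=
  rfl

lemma expRepresentation_hasCoordsIn [CharZero K] [FiniteDimensional K A] (U : Submodule K A)
    (hU : ∀ u ∈ U, IsNilpotent u) {N : ℕ} (hN : ∀ u ∈ U, u ^ N = 0) :
    HasCoordsIn (polyFunOver (vectorGroupFun K U) A)
      fun p : Multiplicative U × A => expRepresentation U hU p.1 p.2 := by
  refine HasCoordsIn.mul (HasCoordsIn.exp (N := N) ?_ fun p => hN _ p.1.toAdd.2)
    (snd_hasCoordsIn _)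
  intro φ
  exact fst_mem_polyFunOver (R := vectorGroupFun K U)
    (r := fun u => (φ ∘ₗ U.subtype) u.toAdd) (Algebra.subset_adjoin ⟨φ ∘ₗ U.subtype, rfl⟩)

/-- If linear maps `e` and `p` recover the constant term and the exponent of every `exp u`, then
the points of `expVariety U` in the affine chart `e ≠ 0` are exactly the points of the orbit.
In the chart, the orbit is defined by `v / e v = exp (p v / e v)`; clearing denominators turns this
into homogeneous equations, which therefore hold on the closure of the orbit. -/
lemma exists_exp_of_mem_expVariety [CharZero K] [FiniteDimensional K A] {U : Submodule K A}
    {N : ℕ} (hN : ∀ u ∈ U, u ^ N = 0) {e : Module.Dual K A} {p : A →ₗ[K] A}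
    (hp : ∀ v, p v ∈ U) (he : ∀ u ∈ U, e (IsNilpotent.exp u) = 1)
    (hpe : ∀ u ∈ U, p (IsNilpotent.exp u) = u) {x : ℙ K A} (hx : x ∈ expVariety U)
    (hex : e x.rep ≠ 0) :
    ∃ u ∈ U, ∃ h : IsNilpotent.exp u ≠ 0, x = Projectivization.mk K _ h := by
  have hexp : ∀ u ∈ U, IsNilpotent.exp u =
      ∑ k ∈ Finset.range N, (((k.factorial : ℚ)⁻¹ : ℚ) : K) • u ^ k := by
    intro u hu
    simp only [IsNilpotent.exp_eq_sum (hN u hu), Rat.cast_smul_eq_qsmul]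
  -- `H v = e v ^ (N + 1) • (v / e v - exp (p v / e v))` where `e v ≠ 0`; it is homogeneous of
  -- degree `N + 1` and polynomial everywhere.
  obtain ⟨H, hHv⟩ : ∃ H : A → A, ∀ v, H v = e v ^ N • v -
      ∑ k ∈ Finset.range N, (e v ^ (N + 1 - k) * (((k.factorial : ℚ)⁻¹ : ℚ) : K)) • p v ^ k :=
    ⟨_, fun _ => rfl⟩
  have hid : HasCoordsIn (polyFun K A) fun v : A => v := fun φ => Algebra.subset_adjoin ⟨φ, rfl⟩
  have hH : HasCoordsIn (polyFun K A) H := by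
    rw [funext hHv]
    refine HasCoordsIn.sub (hid.smul (Subalgebra.pow_mem _ (hid e) N)) ?_
    refine HasCoordsIn.sum fun k _ => HasCoordsIn.smul ?_ ((hid.map p).pow k)
    exact Subalgebra.mul_mem _ (Subalgebra.pow_mem _ (hid e) _) (Subalgebra.algebraMap_mem _ _)
  have hhom : ∀ (c : K) (v : A), H (c • v) = c ^ (N + 1) • H v := by
    intro c v
    simp only [hHv, map_smul, smul_sub, Finset.smul_sum, smul_pow, smul_smul, smul_eq_mul]
    congr 1
    · congr 1
      ring
    · refine Finset.sum_congr rfl fun k hk => ?_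
      congr 1
      have hk' : N + 1 = (N + 1 - k) + k := by
        have := Finset.mem_range.1 hk
        omega
      conv_rhs => rw [hk', pow_add, ← hk']
      ring
  have hφhom : ∀ (φ : Module.Dual K A) (c : K) (v : A),
      φ (H (c • v)) = c ^ (N + 1) * φ (H v) := by
    intro φ c v
    rw [hhom, map_smul, smul_eq_mul]
  have hclosed : IsClosed {x : ℙ K A | ∀ φ : Module.Dual K A, φ (H x.rep) = 0} := by
    rw [Set.ofPred_forall]
    refine isClosed_iInter fun φ => ⟨?_⟩
    exact isOpen_setOf_ne_zero (hH φ) (N + 1) (hφhom φ)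
  have hsub : expVariety U ⊆ {x : ℙ K A | ∀ φ : Module.Dual K A, φ (H x.rep) = 0} := by
    refine closure_minimal ?_ hclosed
    rintro _ ⟨u, hu, h, rfl⟩ φ
    by_contra hne
    refine (rep_mk_ne_zero_iff (f := fun v => φ (H v)) (hφhom φ) h).1 hne ?_
    have h0 : H (IsNilpotent.exp u) = 0 := by
      simp only [hHv, he u hu, hpe u hu, one_pow, one_smul, one_mul]
      rw [← hexp u hu, sub_self]
    simp [h0]
  have hrep : H x.rep = 0 :=
    (Module.forall_dual_apply_eq_zero_iff K _).1 (hsub hx)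
  rw [hHv] at hrep
  -- Dividing the equation `H v = 0` by `e v ^ (N + 1)` recovers the exponent.
  set v := x.rep with hv
  have hmem : (e v)⁻¹ • p v ∈ U := U.smul_mem _ (hp v)
  have hval : IsNilpotent.exp ((e v)⁻¹ • p v) = (e v)⁻¹ • v := by
    have hsum := sub_eq_zero.1 hrep
    have hscale : (e v)⁻¹ • v = (e v)⁻¹ ^ (N + 1) • e v ^ N • v := by
      rw [smul_smul]
      congr 1
      rw [pow_succ', mul_assoc, ← mul_pow, inv_mul_cancel₀ hex, one_pow, mul_one]
    rw [hexp _ hmem, hscale, hsum, Finset.smul_sum]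
    refine Finset.sum_congr rfl fun k hk => ?_
    rw [smul_pow, smul_smul, smul_smul]
    congr 1
    have hk' : N + 1 = (N + 1 - k) + k := by
      have := Finset.mem_range.1 hk
      omega
    conv_rhs => rw [hk', pow_add, ← hk']
    have h1 : (e v)⁻¹ ^ (N + 1 - k) * e v ^ (N + 1 - k) = 1 := by
      rw [← mul_pow, inv_mul_cancel₀ hex, one_pow]
    linear_combination (-(((k.factorial : ℚ)⁻¹ : ℚ) : K) * (e v)⁻¹ ^ k) * h1
  have hne : IsNilpotent.exp ((e v)⁻¹ • p v) ≠ 0 := by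
    rw [hval]
    exact smul_ne_zero (inv_ne_zero hex) x.rep_nonzero
  refine ⟨_, hmem, hne, ?_⟩
  rw [← x.mk_rep, Projectivization.mk_eq_mk_iff']
  exact ⟨e v, by rw [hval, smul_smul, mul_inv_cancel₀ hex, one_smul]⟩

lemma exp_smul_mem_expVariety {U : Submodule K A} (hU : ∀ u ∈ U, IsNilpotent u)
    (u : Multiplicative U) {x : ℙ K A} (hx : x ∈ expVariety U) :
    projAction (expRepresentation U hU) u x ∈ expVariety U := by
  refine map_mem_closure (continuous_projAction _ u) hx ?_
  rintro _ ⟨w, hw, h, rfl⟩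
  have hexp : expRepresentation U hU u (IsNilpotent.exp w) =
      IsNilpotent.exp ((u.toAdd : A) + w) := by
    rw [expRepresentation_apply,
      IsNilpotent.exp_add_of_commute (Commute.all _ _) (hU _ u.toAdd.2) (hU w hw)]
  refine ⟨(u.toAdd : A) + w, U.add_mem u.toAdd.2 hw, ?_, ?_⟩
  · rw [← hexp]
    exact (expRepresentation U hU u).map_ne_zero_iff.2 h
  · rw [projAction_mk]
    exact mk_congr hexp _ _

lemma projAction_exp_mk_one [Nontrivial A] {U : Submodule K A} (hU : ∀ u ∈ U, IsNilpotent u)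
    (u : Multiplicative U) :
    projAction (expRepresentation U hU) u (Projectivization.mk K 1 one_ne_zero) =
      Projectivization.mk K (IsNilpotent.exp (u.toAdd : A)) (exp_ne_zero (hU _ u.toAdd.2)) := by
  rw [projAction_mk]
  exact mk_congr (by rw [expRepresentation_apply, mul_one]) _ _

lemma range_projAction_exp_mk_one [Nontrivial A] {U : Submodule K A}
    (hU : ∀ u ∈ U, IsNilpotent u) :
    (Set.range fun u =>
      projAction (expRepresentation U hU) u (Projectivization.mk K 1 one_ne_zero)) =
    {p | ∃ u ∈ U, ∃ h : IsNilpotent.exp u ≠ 0, p = Projectivization.mk K _ h} := by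
  ext x
  constructor
  · rintro ⟨u, rfl⟩
    exact ⟨_, u.toAdd.2, _, projAction_exp_mk_one hU u⟩
  · rintro ⟨u, hu, h, rfl⟩
    exact ⟨Multiplicative.ofAdd ⟨u, hu⟩, projAction_exp_mk_one hU _⟩

lemma mk_exp_mem_expVariety {U : Submodule K A} {u : A} (hu : u ∈ U)
    (h : IsNilpotent.exp u ≠ 0) : Projectivization.mk K _ h ∈ expVariety U :=
  subset_closure ⟨u, hu, h, rfl⟩

lemma mk_one_mem_expVariety [Nontrivial A] (U : Submodule K A) :
    Projectivization.mk K (1 : A) one_ne_zero ∈ expVariety U :=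
  subset_closure ⟨0, U.zero_mem, by simp [IsNilpotent.exp_zero],
    mk_congr IsNilpotent.exp_zero.symm _ _⟩

/-- The stabilizer in `U` of the line through `1` is trivial. -/
lemma eq_of_projAction_exp_mk_one [Nontrivial A] {U : Submodule K A}
    (hU : ∀ u ∈ U, IsNilpotent u) {e : Module.Dual K A} {p : A →ₗ[K] A}
    (he : ∀ u ∈ U, e (IsNilpotent.exp u) = 1) (hpe : ∀ u ∈ U, p (IsNilpotent.exp u) = u)
    {u v : Multiplicative U}
    (h : projAction (expRepresentation U hU) u (Projectivization.mk K 1 one_ne_zero) =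
      projAction (expRepresentation U hU) v (Projectivization.mk K 1 one_ne_zero)) : u = v := by
  rw [projAction_exp_mk_one, projAction_exp_mk_one] at h
  have h' := congrArg p (eq_of_mk_eq_mk h (he _ u.toAdd.2) (he _ v.toAdd.2))
  rw [hpe _ u.toAdd.2, hpe _ v.toAdd.2] at h'
  exact Multiplicative.toAdd.injective (Subtype.ext h')

lemma isInducedAdditiveAction_exp [CharZero K] [FiniteDimensional K A] [Nontrivial A]
    {U : Submodule K A} (hU : ∀ u ∈ U, IsNilpotent u) {N : ℕ} (hN : ∀ u ∈ U, u ^ N = 0)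
    {e : Module.Dual K A} {p : A →ₗ[K] A}
    (he : ∀ u ∈ U, e (IsNilpotent.exp u) = 1) (hpe : ∀ u ∈ U, p (IsNilpotent.exp u) = u) :
    IsInducedAdditiveAction (projAction (expRepresentation U hU)) (expVariety U) where
  regular := isRegularMap_projAction (expRepresentation_hasCoordsIn U hU hN) _
  effective u v h := eq_of_projAction_exp_mk_one hU he hpe (by rw [h])
  orbitClosure := ⟨Projectivization.mk K 1 one_ne_zero, by
    rw [range_projAction_exp_mk_one hU]
    rfl⟩

lemma isAdditiveAction_exp [CharZero K] [FiniteDimensional K A] [Nontrivial A]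
    {U : Submodule K A} (hU : ∀ u ∈ U, IsNilpotent u) {N : ℕ} (hN : ∀ u ∈ U, u ^ N = 0)
    {e : Module.Dual K A} {p : A →ₗ[K] A} (hp : ∀ v, p v ∈ U)
    (he : ∀ u ∈ U, e (IsNilpotent.exp u) = 1) (hpe : ∀ u ∈ U, p (IsNilpotent.exp u) = u) :
    IsAdditiveAction (expVariety U)
      (restrictAction (projAction (expRepresentation U hU)) (expVariety U)
        fun u _ hx => exp_smul_mem_expVariety hU u hx) where
  regular := isRegularMap_projAction (expRepresentation_hasCoordsIn U hU hN) _
  effective u v h := by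
    have h1 := DFunLike.congr_fun h ⟨_, mk_one_mem_expVariety U⟩
    exact eq_of_projAction_exp_mk_one hU he hpe (congrArg Subtype.val h1)
  openOrbit := by
    refine ⟨⟨_, mk_one_mem_expVariety U⟩, ?_⟩
    convert (isOpen_setOf_dual_ne_zero e).preimage continuous_subtype_val using 1
    ext ⟨x, hx⟩
    constructor
    · rintro ⟨u, hu⟩
      have hu' := (projAction_exp_mk_one hU u).symm.trans (congrArg Subtype.val hu)
      change e x.rep ≠ 0
      change _ = x at hu'
      rw [← hu', dual_rep_mk_ne_zero_iff, he _ u.toAdd.2]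
      exact one_ne_zero
    · intro hex
      obtain ⟨u, hu, h, rfl⟩ := exists_exp_of_mem_expVariety hN hp he hpe hx hex
      exact ⟨Multiplicative.ofAdd ⟨u, hu⟩, Subtype.ext (projAction_exp_mk_one hU _)⟩

end Exponential

/-! ### Monomial algebras: nilpotency and coordinates -/

section MonomialAlgebra

open MvPolynomial

variable {K : Type*} [Field K] {n : ℕ} {I : Ideal (MvPolynomial (Fin n) K)}

/-- A monomial occurring in an element of a monomial ideal lies in that ideal. -/
lemma IsMonomialIdeal.coeff_eq_zero (hI : IsMonomialIdeal I) {m : Fin n →₀ ℕ}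
    (hm : monomial m (1 : K) ∉ I) {f : MvPolynomial (Fin n) K} (hf : f ∈ I) : coeff m f = 0 := by
  obtain ⟨S, rfl⟩ := hI
  by_contra h
  obtain ⟨s, hs, hsm⟩ := mem_ideal_span_monomial_image.1 hf m (mem_support_iff.2 h)
  refine hm (mem_ideal_span_monomial_image.2 fun k hk => ⟨s, hs, ?_⟩)
  rwa [Finset.mem_singleton.1 (support_monomial_subset hk)]

/-- The coefficient at a monomial outside a monomial ideal is well defined on the quotient. -/
lemma IsMonomialIdeal.exists_dual_coeff (hI : IsMonomialIdeal I) {m : Fin n →₀ ℕ}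
    (hm : monomial m (1 : K) ∉ I) :
    ∃ c : Module.Dual K (MvPolynomial (Fin n) K ⧸ I),
      ∀ f, c (Ideal.Quotient.mk I f) = coeff m f :=
  ⟨(I.restrictScalars K).liftQ (lcoeff K m) fun _ hf => hI.coeff_eq_zero hm hf, fun _ => rfl⟩

variable (I) in
lemma mk_linear_form (a : Fin n → K) :
    Ideal.Quotient.mk I (∑ i, a i • X i) = ∑ i, a i • Ideal.Quotient.mk I (X i) := by
  rw [map_sum]
  rfl

lemma mem_variableSpan_iff {u : MvPolynomial (Fin n) K ⧸ I} :
    u ∈ variableSpan I ↔ ∃ a : Fin n → K, ∑ i, a i • Ideal.Quotient.mk I (X i) = u :=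
  Submodule.mem_span_range_iff_exists_fun K

lemma sum_mem_variableSpan (a : Fin n → K) :
    ∑ i, a i • Ideal.Quotient.mk I (X i) ∈ variableSpan I :=
  mem_variableSpan_iff.2 ⟨a, rfl⟩

lemma adjoin_variableSpan :
    Algebra.adjoin K (variableSpan I : Set (MvPolynomial (Fin n) K ⧸ I)) = ⊤ := by
  refine top_le_iff.1 ?_
  have h : Algebra.adjoin K (Set.range fun i => Ideal.Quotient.mk I (X i : MvPolynomial (Fin n) K))
      = ⊤ := by
    have hr : (Set.range fun i => Ideal.Quotient.mk I (X i : MvPolynomial (Fin n) K)) =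
        Ideal.Quotient.mkₐ K I '' Set.range X := by
      rw [← Set.range_comp]
      rfl
    rw [hr, ← AlgHom.map_adjoin, adjoin_range_X, Algebra.map_top]
    exact (AlgHom.range_eq_top _).2 (Ideal.Quotient.mkₐ_surjective K I)
  rw [← h]
  exact Algebra.adjoin_mono Submodule.subset_span

/-- In a finite-dimensional monomial algebra the variables are nilpotent: a variable satisfies
a polynomial relation, and each monomial of that relation is zero in the algebra. -/
lemma IsMonomialIdeal.isNilpotent_mk_X (hI : IsMonomialIdeal I)
    [FiniteDimensional K (MvPolynomial (Fin n) K ⧸ I)] (i : Fin n) :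
    IsNilpotent (Ideal.Quotient.mk I (X i)) := by
  obtain ⟨p, hp, hp0⟩ := Algebra.IsIntegral.isIntegral (R := K) (Ideal.Quotient.mk I (X i))
  set d := p.natDegree
  refine ⟨d, ?_⟩
  by_contra hne
  have hm : monomial (Finsupp.single i d) (1 : K) ∉ I := by
    rwa [← X_pow_eq_monomial, ← Ideal.Quotient.eq_zero_iff_mem, map_pow]
  have hmem : Polynomial.aeval (X i : MvPolynomial (Fin n) K) p ∈ I := by
    rw [← Ideal.Quotient.eq_zero_iff_mem, ← Ideal.Quotient.mkₐ_eq_mk K,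
      ← Polynomial.aeval_algHom_apply]
    exact hp0
  have hc := hI.coeff_eq_zero hm hmem
  rw [Polynomial.aeval_eq_sum_range, coeff_sum, Finset.sum_eq_single d] at hc
  · simp [X_pow_eq_monomial, d, hp.coeff_natDegree] at hc
  · intro k _ hk
    rw [coeff_smul, X_pow_eq_monomial, coeff_monomial, if_neg, smul_zero]
    exact fun h => hk (Finsupp.single_injective i h)
  · intro h
    exact absurd (Finset.mem_range.2 (Nat.lt_succ_self _)) h

lemma IsMonomialIdeal.isNilpotent_of_mem (hI : IsMonomialIdeal I)
    [FiniteDimensional K (MvPolynomial (Fin n) K ⧸ I)] {u : MvPolynomial (Fin n) K ⧸ I}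
    (hu : u ∈ variableSpan I) : IsNilpotent u := by
  have h : variableSpan I ≤
      (nilradical (MvPolynomial (Fin n) K ⧸ I)).restrictScalars K := by
    refine Submodule.span_le.2 ?_
    rintro _ ⟨i, rfl⟩
    exact hI.isNilpotent_mk_X i
  exact h hu

lemma IsMonomialIdeal.isSPair (hI : IsMonomialIdeal I)
    [FiniteDimensional K (MvPolynomial (Fin n) K ⧸ I)]
    [IsLocalRing (MvPolynomial (Fin n) K ⧸ I)] : IsSPair (variableSpan I) where
  isLocalRing := inferInstance
  le_maximalIdeal u hu := by
    rw [IsLocalRing.mem_maximalIdeal, mem_nonunits_iff]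
    exact (hI.isNilpotent_of_mem hu).not_isUnit
  adjoin_eq_top := adjoin_variableSpan

lemma IsMonomialIdeal.exists_pow_eq_zero (hI : IsMonomialIdeal I)
    [FiniteDimensional K (MvPolynomial (Fin n) K ⧸ I)] :
    ∃ N : ℕ, 2 ≤ N ∧ ∀ u ∈ variableSpan I, u ^ N = 0 := by
  have : IsArtinianRing (MvPolynomial (Fin n) K ⧸ I) := IsArtinianRing.of_finite K _
  obtain ⟨N, hN⟩ := IsArtinianRing.isNilpotent_nilradical (R := MvPolynomial (Fin n) K ⧸ I)
  refine ⟨N + 2, by omega, fun u hu => ?_⟩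
  have h : u ^ N ∈ nilradical (MvPolynomial (Fin n) K ⧸ I) ^ N :=
    Ideal.pow_mem_pow (hI.isNilpotent_of_mem hu) N
  rw [hN] at h
  rw [pow_add, (Ideal.mem_bot.1 h : u ^ N = 0), zero_mul]

/-- The coefficient of the exponential of a linear form at a monomial of degree `d` comes from the
term of degree `d` of the exponential series. -/
lemma dual_coeff_exp [CharZero K] {N : ℕ}
    (hN : ∀ u ∈ variableSpan I, u ^ N = 0) {m : Fin n →₀ ℕ} (hm : m.degree < N)
    {c : Module.Dual K (MvPolynomial (Fin n) K ⧸ I)}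
    (hc : ∀ f, c (Ideal.Quotient.mk I f) = coeff m f) (a : Fin n → K) :
    c (IsNilpotent.exp (∑ i, a i • Ideal.Quotient.mk I (X i))) =
      (((m.degree.factorial : ℚ)⁻¹ : ℚ) : K) * coeff m ((∑ i, a i • X i) ^ m.degree) := by
  have hl : (∑ i, a i • X i : MvPolynomial (Fin n) K).IsHomogeneous 1 :=
    IsHomogeneous.sum _ _ _ fun i _ => by
      rw [smul_eq_C_mul]
      simpa using (isHomogeneous_C (Fin n) (a i)).mul (isHomogeneous_X K i)
  rw [IsNilpotent.exp_eq_sum (hN _ (sum_mem_variableSpan a)), ← mk_linear_form, map_sum,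
    Finset.sum_eq_single m.degree]
  · rw [← Rat.cast_smul_eq_qsmul K, map_smul, ← map_pow, hc, smul_eq_mul]
  · intro k _ hk
    have hz : coeff m ((∑ i, a i • X i : MvPolynomial (Fin n) K) ^ k) = 0 :=
      (hl.pow k).coeff_eq_zero (by simpa using hk.symm)
    rw [← Rat.cast_smul_eq_qsmul K, map_smul, ← map_pow, hc, hz, smul_zero]
  · intro h
    exact absurd (Finset.mem_range.2 hm) h

/-- There are functionals reading off the constant term and the linear coefficients of the
exponential of a linear form. A variable lying in `I` has no well-defined coefficient; its
functional is chosen to be zero. -/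
lemma IsMonomialIdeal.exists_dual_exp [CharZero K] (hI : IsMonomialIdeal I)
    [Nontrivial (MvPolynomial (Fin n) K ⧸ I)] {N : ℕ} (hN2 : 2 ≤ N)
    (hN : ∀ u ∈ variableSpan I, u ^ N = 0) :
    ∃ (e : Module.Dual K (MvPolynomial (Fin n) K ⧸ I))
      (c : Fin n → Module.Dual K (MvPolynomial (Fin n) K ⧸ I)), ∀ a : Fin n → K,
      e (IsNilpotent.exp (∑ i, a i • Ideal.Quotient.mk I (X i))) = 1 ∧
      ∀ i, c i (IsNilpotent.exp (∑ i, a i • Ideal.Quotient.mk I (X i))) =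
        open Classical in if X i ∈ I then 0 else a i := by
  classical
  have h1 : monomial (0 : Fin n →₀ ℕ) (1 : K) ∉ I := by
    intro h
    have h' : (Ideal.Quotient.mk I) 1 = 0 := Ideal.Quotient.eq_zero_iff_mem.2 h
    exact one_ne_zero ((map_one (Ideal.Quotient.mk I)).symm.trans h')
  obtain ⟨e, he⟩ := hI.exists_dual_coeff h1
  have hc : ∀ i : Fin n, ∃ c : Module.Dual K (MvPolynomial (Fin n) K ⧸ I), ∀ a : Fin n → K,
      c (IsNilpotent.exp (∑ i, a i • Ideal.Quotient.mk I (X i))) =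
        if X i ∈ I then 0 else a i := by
    intro i
    by_cases hi : (X i : MvPolynomial (Fin n) K) ∈ I
    · exact ⟨0, fun a => by simp [hi]⟩
    · obtain ⟨c, hc⟩ := hI.exists_dual_coeff (m := Finsupp.single i 1) hi
      refine ⟨c, fun a => ?_⟩
      rw [dual_coeff_exp hN (by simpa using Nat.lt_of_lt_of_le one_lt_two hN2) hc, if_neg hi]
      simp [coeff_sum, coeff_X, Finsupp.single_left_inj]
  choose c hc using hc
  refine ⟨e, c, fun a => ⟨?_, fun i => hc i a⟩⟩
  rw [dual_coeff_exp hN (by simpa using by omega) he]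
  simp

/-! ### The torus action -/

/-- The endomorphism of a monomial algebra multiplying the `i`-th variable by `t i`. -/
def scaleHom (hI : IsMonomialIdeal I) (t : Fin n → K) :
    (MvPolynomial (Fin n) K ⧸ I) →ₐ[K] (MvPolynomial (Fin n) K ⧸ I) :=
  Ideal.Quotient.liftₐ I (aeval fun i => t i • Ideal.Quotient.mk I (X i)) <| by
    have h : I ≤ RingHom.ker (aeval (R := K) fun i => t i • Ideal.Quotient.mk I (X i)) := by
      obtain ⟨S, hS⟩ := hI
      conv_lhs => rw [hS]
      refine Ideal.span_le.2 ?_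
      rintro _ ⟨m, hm, rfl⟩
      have hmI : monomial m (1 : K) ∈ I := by
        rw [hS]
        exact Ideal.subset_span ⟨m, hm, rfl⟩
      have h0 : ∏ i, Ideal.Quotient.mk I (X i) ^ m i = 0 := by
        rw [← Ideal.Quotient.eq_zero_iff_mem, monomial_eq, C_1, one_mul,
          Finsupp.prod_fintype _ _ (by simp), map_prod] at hmI
        simpa using hmI
      rw [SetLike.mem_coe, RingHom.mem_ker, aeval_monomial, Finsupp.prod_fintype _ _ (by simp)]
      simp [smul_pow, Finset.prod_smul, h0]
    exact fun f hf => h hf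

lemma scaleHom_mk_X (hI : IsMonomialIdeal I) (t : Fin n → K) (i : Fin n) :
    scaleHom hI t (Ideal.Quotient.mk I (X i)) = t i • Ideal.Quotient.mk I (X i) :=
  aeval_X _ i

lemma scaleHom_mk_monomial (hI : IsMonomialIdeal I) (t : Fin n → K) (m : Fin n →₀ ℕ) :
    scaleHom hI t (Ideal.Quotient.mk I (monomial m 1)) =
      (∏ i, t i ^ m i) • Ideal.Quotient.mk I (monomial m 1) := by
  rw [monomial_eq, C_1, one_mul, Finsupp.prod_fintype _ _ (by simp), map_prod, map_prod]
  simp only [map_pow, scaleHom_mk_X, smul_pow, Finset.prod_smul]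

lemma scaleHom_sum (hI : IsMonomialIdeal I) (t a : Fin n → K) :
    scaleHom hI t (∑ i, a i • Ideal.Quotient.mk I (X i)) =
      ∑ i, (t i * a i) • Ideal.Quotient.mk I (X i) := by
  simp only [map_sum, map_smul, scaleHom_mk_X, smul_smul, mul_comm]

lemma algHom_ext_mk_X {f g : (MvPolynomial (Fin n) K ⧸ I) →ₐ[K] (MvPolynomial (Fin n) K ⧸ I)}
    (h : ∀ i, f (Ideal.Quotient.mk I (X i)) = g (Ideal.Quotient.mk I (X i))) : f = g :=
  Ideal.Quotient.algHom_ext K (MvPolynomial.algHom_ext h)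

/-- The linear action of the torus on a monomial algebra. -/
def torusRepresentation (hI : IsMonomialIdeal I) :
    (Fin n → Kˣ) →*
      ((MvPolynomial (Fin n) K ⧸ I) ≃ₗ[K] (MvPolynomial (Fin n) K ⧸ I)) :=
  representationOfEnd
    { toFun := fun t => (scaleHom hI fun i => (t i : K)).toLinearMap
      map_one' := by
        have h : (scaleHom hI fun i => ((1 : Fin n → Kˣ) i : K)) = AlgHom.id K _ :=
          algHom_ext_mk_X fun i => by simp [scaleHom_mk_X]
        rw [h]
        rfl
      map_mul' := fun s t => by
        have h : (scaleHom hI fun i => ((s * t) i : K)) =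
            (scaleHom hI fun i => (s i : K)).comp (scaleHom hI fun i => (t i : K)) :=
          algHom_ext_mk_X fun i => by simp [scaleHom_mk_X, smul_smul, mul_comm]
        rw [h]
        rfl }

lemma torusRepresentation_apply (hI : IsMonomialIdeal I) (t : Fin n → Kˣ)
    (v : MvPolynomial (Fin n) K ⧸ I) :
    torusRepresentation hI t v = scaleHom hI (fun i => (t i : K)) v :=
  rfl

lemma torusRepresentation_mem_variableSpan (hI : IsMonomialIdeal I) (t : Fin n → Kˣ)
    {u : MvPolynomial (Fin n) K ⧸ I} (hu : u ∈ variableSpan I) :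
    torusRepresentation hI t u ∈ variableSpan I := by
  obtain ⟨a, rfl⟩ := mem_variableSpan_iff.1 hu
  rw [torusRepresentation_apply, scaleHom_sum]
  exact sum_mem_variableSpan _

variable (I) in
lemma span_range_mk_monomial :
    Submodule.span K (Set.range fun m : Fin n →₀ ℕ => Ideal.Quotient.mk I (monomial m (1 : K))) =
      ⊤ := by
  have hr : (Set.range fun m : Fin n →₀ ℕ => Ideal.Quotient.mk I (monomial m (1 : K))) =
      (Ideal.Quotient.mkₐ K I).toLinearMap '' Set.range fun m => monomial m (1 : K) := by
    rw [← Set.range_comp]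
    rfl
  have hb : Submodule.span K (Set.range fun m : Fin n →₀ ℕ => monomial m (1 : K)) = ⊤ := by
    simpa using (basisMonomials (Fin n) K).span_eq
  rw [hr, ← Submodule.map_span, hb, Submodule.map_top]
  exact LinearMap.range_eq_top.2 (Ideal.Quotient.mkₐ_surjective K I)

/-- In a basis consisting of monomials the torus acts diagonally, through Laurent monomials. -/
lemma torusRepresentation_hasCoordsIn (hI : IsMonomialIdeal I)
    [FiniteDimensional K (MvPolynomial (Fin n) K ⧸ I)] :
    HasCoordsIn (polyFunOver (torusFun K n) (MvPolynomial (Fin n) K ⧸ I))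
      fun p : (Fin n → Kˣ) × (MvPolynomial (Fin n) K ⧸ I) => torusRepresentation hI p.1 p.2 := by
  let b := Module.Basis.ofSpan (span_range_mk_monomial I).ge
  have : Fintype ↑((linearIndepOn_empty K id).extend (Set.empty_subset
      (Set.range fun m : Fin n →₀ ℕ => Ideal.Quotient.mk I (monomial m (1 : K))))) :=
    FiniteDimensional.fintypeBasisIndex b
  have hb : ∀ j, ∃ m : Fin n →₀ ℕ, Ideal.Quotient.mk I (monomial m (1 : K)) = b j :=
    fun j => Module.Basis.ofSpan_subset (span_range_mk_monomial I).ge ⟨j, rfl⟩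
  choose m hm using hb
  have h : (fun p : (Fin n → Kˣ) × (MvPolynomial (Fin n) K ⧸ I) =>
      torusRepresentation hI p.1 p.2) =
      fun p => ∑ j, (∏ i, (p.1 i : K) ^ m j i) • b.coord j p.2 • b j := by
    ext ⟨t, v⟩
    conv_lhs => rw [← b.sum_repr v]
    rw [map_sum]
    refine Finset.sum_congr rfl fun j _ => ?_
    rw [map_smul, ← hm j, torusRepresentation_apply, scaleHom_mk_monomial, smul_comm,
      Module.Basis.coord_apply]
  rw [h]
  refine HasCoordsIn.sum fun j _ => HasCoordsIn.smul ?_ (HasCoordsIn.smul ?_ (HasCoordsIn.const _))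
  · refine fst_mem_polyFunOver (R := torusFun K n) (r := fun t => ∏ i, (t i : K) ^ m j i) ?_
    have := (torusFun K n).prod_mem (t := Finset.univ)
      (f := fun (i : Fin n) (t : Fin n → Kˣ) => (t i : K) ^ m j i) fun i _ =>
        (torusFun K n).pow_mem (x := fun t => (t i : K))
          (Algebra.subset_adjoin (Or.inl ⟨i, rfl⟩)) (m j i)
    convert this using 1
    ext t
    simp
  · exact snd_hasCoordsIn _ (b.coord j)

end MonomialAlgebra

/-! ### The variety of a monomial pair -/

section MonomialTorus

open MvPolynomial

variable {K : Type*} [Field K] [CharZero K] {n : ℕ} {I : Ideal (MvPolynomial (Fin n) K)}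

lemma torusRepresentation_exp (hI : IsMonomialIdeal I)
    [FiniteDimensional K (MvPolynomial (Fin n) K ⧸ I)] (t : Fin n → Kˣ)
    {u : MvPolynomial (Fin n) K ⧸ I} (hu : u ∈ variableSpan I) :
    torusRepresentation hI t (IsNilpotent.exp u) =
      IsNilpotent.exp (torusRepresentation hI t u) :=
  IsNilpotent.map_exp (hI.isNilpotent_of_mem hu) (scaleHom hI fun i => (t i : K))

lemma torus_smul_mem_expVariety (hI : IsMonomialIdeal I)
    [FiniteDimensional K (MvPolynomial (Fin n) K ⧸ I)] (t : Fin n → Kˣ)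
    {x : ℙ K (MvPolynomial (Fin n) K ⧸ I)} (hx : x ∈ expVariety (variableSpan I)) :
    projAction (torusRepresentation hI) t x ∈ expVariety (variableSpan I) := by
  refine map_mem_closure (continuous_projAction _ t) hx ?_
  rintro _ ⟨u, hu, h, rfl⟩
  have hexp := torusRepresentation_exp hI t hu
  refine ⟨_, torusRepresentation_mem_variableSpan hI t hu, ?_, ?_⟩
  · rw [← hexp]
    exact (torusRepresentation hI t).map_ne_zero_iff.2 h
  · rw [projAction_mk]
    exact mk_congr hexp _ _

lemma torus_conj_exp (hI : IsMonomialIdeal I)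
    [FiniteDimensional K (MvPolynomial (Fin n) K ⧸ I)] (t : Fin n → Kˣ)
    {u : MvPolynomial (Fin n) K ⧸ I} (hu : u ∈ variableSpan I)
    (v : MvPolynomial (Fin n) K ⧸ I) :
    torusRepresentation hI t (IsNilpotent.exp u * v) =
      IsNilpotent.exp (torusRepresentation hI t u) * torusRepresentation hI t v := by
  rw [← torusRepresentation_exp hI t hu]
  exact map_mul (scaleHom hI fun i => (t i : K)) _ _

/-- The action of `exp U` on the variety of a monomial pair. -/
def additiveAction (hI : IsMonomialIdeal I) [FiniteDimensional K (MvPolynomial (Fin n) K ⧸ I)] :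
    Multiplicative (variableSpan I) →* Equiv.Perm (expVariety (variableSpan I)) :=
  restrictAction
    (projAction (expRepresentation (variableSpan I) fun _ hu => hI.isNilpotent_of_mem hu))
    (expVariety (variableSpan I)) fun u _ hx => exp_smul_mem_expVariety _ u hx

/-- The torus action on the variety of a monomial pair. -/
def torusAction (hI : IsMonomialIdeal I) [FiniteDimensional K (MvPolynomial (Fin n) K ⧸ I)] :
    (Fin n → Kˣ) →* Equiv.Perm (expVariety (variableSpan I)) :=
  restrictAction (projAction (torusRepresentation hI)) (expVariety (variableSpan I))
    fun t _ hx => torus_smul_mem_expVariety hI t hx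

lemma torusAction_mul_additiveAction (hI : IsMonomialIdeal I)
    [FiniteDimensional K (MvPolynomial (Fin n) K ⧸ I)] (t : Fin n → Kˣ)
    (u : Multiplicative (variableSpan I)) :
    torusAction hI t * additiveAction hI u =
      additiveAction hI (Multiplicative.ofAdd
        ⟨_, torusRepresentation_mem_variableSpan hI t u.toAdd.2⟩) * torusAction hI t := by
  ext ⟨x, hx⟩
  induction x using Projectivization.ind with
  | h v hv => exact mk_congr (torus_conj_exp hI t u.toAdd.2 v) _ _

lemma torusAction_range_le_normalizer (hI : IsMonomialIdeal I)
    [FiniteDimensional K (MvPolynomial (Fin n) K ⧸ I)] :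
    (torusAction hI).range ≤
      Subgroup.normalizer ((additiveAction hI).range : Set (Equiv.Perm _)) := by
  have hconj : ∀ t, ∀ g ∈ (additiveAction hI).range,
      torusAction hI t * g * (torusAction hI t)⁻¹ ∈ (additiveAction hI).range := by
    rintro t _ ⟨u, rfl⟩
    rw [torusAction_mul_additiveAction, mul_inv_cancel_right]
    exact ⟨_, rfl⟩
  rintro _ ⟨t, rfl⟩
  rw [Subgroup.mem_normalizer_iff]
  refine fun g => ⟨hconj t g, fun hg => ?_⟩
  have h := hconj t⁻¹ _ hg
  simpa [mul_assoc] using h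

variable (I) in
/-- The point of the variety given by the exponential of the sum of all variables. -/
def torusBasePoint [FiniteDimensional K (MvPolynomial (Fin n) K ⧸ I)]
    [Nontrivial (MvPolynomial (Fin n) K ⧸ I)] (hI : IsMonomialIdeal I) :
    expVariety (variableSpan I) :=
  ⟨Projectivization.mk K (IsNilpotent.exp (∑ i, (1 : K) • Ideal.Quotient.mk I (X i)))
      (exp_ne_zero (hI.isNilpotent_of_mem (sum_mem_variableSpan _))),
    mk_exp_mem_expVariety (sum_mem_variableSpan fun _ => (1 : K)) _⟩

lemma torusAction_torusBasePoint [FiniteDimensional K (MvPolynomial (Fin n) K ⧸ I)]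
    [Nontrivial (MvPolynomial (Fin n) K ⧸ I)] (hI : IsMonomialIdeal I) (t : Fin n → Kˣ) :
    (torusAction hI t (torusBasePoint I hI) : ℙ K (MvPolynomial (Fin n) K ⧸ I)) =
      Projectivization.mk K (IsNilpotent.exp (∑ i, (t i : K) • Ideal.Quotient.mk I (X i)))
        (exp_ne_zero (hI.isNilpotent_of_mem (sum_mem_variableSpan _))) := by
  refine mk_congr (?_ : torusRepresentation hI t _ = _) _ _
  rw [torusRepresentation_exp hI t (sum_mem_variableSpan _), torusRepresentation_apply,
    scaleHom_sum]
  simp only [mul_one]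

/-- The linear coefficients of `exp (∑ tᵢ xᵢ)` determine `t`, so that the stabilizer of the base
point is trivial. -/
lemma torusAction_injective [FiniteDimensional K (MvPolynomial (Fin n) K ⧸ I)]
    [Nontrivial (MvPolynomial (Fin n) K ⧸ I)] (hI : IsMonomialIdeal I)
    (hX : ∀ i, (X i : MvPolynomial (Fin n) K) ∉ I) : Function.Injective (torusAction hI) := by
  obtain ⟨N, hN2, hN⟩ := hI.exists_pow_eq_zero
  obtain ⟨e, c, hec⟩ := hI.exists_dual_exp hN2 hN
  intro s t hst
  have h : (torusAction hI s (torusBasePoint I hI) : ℙ K (MvPolynomial (Fin n) K ⧸ I)) =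
      torusAction hI t (torusBasePoint I hI) := by rw [hst]
  rw [torusAction_torusBasePoint, torusAction_torusBasePoint] at h
  have h' := eq_of_mk_eq_mk h (hec _).1 (hec _).1
  ext i
  simpa [(hec _).2, hX] using congrArg (c i) h'

/-- Given functionals reading off the constant term and the linear coefficients, projecting onto
the linear part recovers the exponent. -/
lemma sum_dual_exp {c : Fin n → Module.Dual K (MvPolynomial (Fin n) K ⧸ I)}
    (hc : ∀ (a : Fin n → K) (i : Fin n),
      c i (IsNilpotent.exp (∑ i, a i • Ideal.Quotient.mk I (X i))) =
      open Classical in if X i ∈ I then 0 else a i)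
    {u : MvPolynomial (Fin n) K ⧸ I} (hu : u ∈ variableSpan I) :
    ∑ i, c i (IsNilpotent.exp u) • Ideal.Quotient.mk I (X i) = u := by
  obtain ⟨a, rfl⟩ := mem_variableSpan_iff.1 hu
  refine Finset.sum_congr rfl fun i _ => ?_
  rw [hc]
  split_ifs with h
  · rw [Ideal.Quotient.eq_zero_iff_mem.2 h, smul_zero, smul_zero]
  · rfl

/-- The functionals required to describe the orbit of `exp U` inside an affine chart exist for
monomial algebras; the projection onto `U` is assembled from the linear coefficients. -/
lemma IsMonomialIdeal.exists_chart [FiniteDimensional K (MvPolynomial (Fin n) K ⧸ I)]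
    [Nontrivial (MvPolynomial (Fin n) K ⧸ I)] (hI : IsMonomialIdeal I) :
    ∃ (N : ℕ) (e : Module.Dual K (MvPolynomial (Fin n) K ⧸ I))
      (c : Fin n → Module.Dual K (MvPolynomial (Fin n) K ⧸ I))
      (p : (MvPolynomial (Fin n) K ⧸ I) →ₗ[K] (MvPolynomial (Fin n) K ⧸ I)),
      (∀ u ∈ variableSpan I, u ^ N = 0) ∧ (∀ v, p v ∈ variableSpan I) ∧
      (∀ u ∈ variableSpan I, e (IsNilpotent.exp u) = 1) ∧
      (∀ u ∈ variableSpan I, p (IsNilpotent.exp u) = u) ∧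
      ∀ (a : Fin n → K) (i : Fin n),
        c i (IsNilpotent.exp (∑ i, a i • Ideal.Quotient.mk I (X i))) =
        open Classical in if X i ∈ I then 0 else a i := by
  obtain ⟨N, hN2, hN⟩ := hI.exists_pow_eq_zero
  obtain ⟨e, c, hec⟩ := hI.exists_dual_exp hN2 hN
  refine ⟨N, e, c, ∑ i, (c i).smulRight (Ideal.Quotient.mk I (X i)), hN, ?_, ?_, ?_,
    fun a => (hec a).2⟩
  · intro v
    simpa using sum_mem_variableSpan (I := I) fun i => c i v
  · intro u hu
    obtain ⟨a, rfl⟩ := mem_variableSpan_iff.1 hu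
    exact (hec a).1
  · intro u hu
    simpa using sum_dual_exp (fun a => (hec a).2) hu

/-- The torus orbit of the base point consists of the points `exp (∑ aᵢ xᵢ)` such that `aᵢ ≠ 0`
whenever `xᵢ ∉ I`, so it is cut out by finitely many nonvanishing conditions. -/
lemma hasOpenOrbit_torusAction [FiniteDimensional K (MvPolynomial (Fin n) K ⧸ I)]
    [Nontrivial (MvPolynomial (Fin n) K ⧸ I)] (hI : IsMonomialIdeal I) :
    HasOpenOrbit (expVariety (variableSpan I)) (torusAction hI) := by
  classical
  obtain ⟨N, e, c, p, hN, hp, he, hpe, hc⟩ := hI.exists_chart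
  refine ⟨torusBasePoint I hI, ?_⟩
  have hopen : IsOpen ({x : ℙ K (MvPolynomial (Fin n) K ⧸ I) | e x.rep ≠ 0} ∩
      ⋂ i : {i : Fin n // X i ∉ I}, {x | c i x.rep ≠ 0}) :=
    (isOpen_setOf_dual_ne_zero e).inter
      (isOpen_iInter_of_finite fun i => isOpen_setOf_dual_ne_zero (c i))
  convert hopen.preimage continuous_subtype_val using 1
  ext ⟨x, hx⟩
  constructor
  · rintro ⟨t, ht⟩
    have ht' := (torusAction_torusBasePoint hI t).symm.trans (congrArg Subtype.val ht)
    change _ = x at ht'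
    subst ht'
    refine ⟨(dual_rep_mk_ne_zero_iff e _).2 ?_, Set.mem_iInter.2 fun i =>
      (dual_rep_mk_ne_zero_iff (c i) _).2 ?_⟩
    · rw [he _ (sum_mem_variableSpan _)]
      exact one_ne_zero
    · rw [hc, if_neg i.2]
      exact (t i).ne_zero
  · rintro ⟨hex, hcx⟩
    obtain ⟨u, hu, h, rfl⟩ := exists_exp_of_mem_expVariety hN hp he hpe hx hex
    obtain ⟨a, rfl⟩ := mem_variableSpan_iff.1 hu
    have ha : ∀ i, X i ∉ I → a i ≠ 0 := by
      intro i hi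
      have := Set.mem_iInter.1 hcx ⟨i, hi⟩
      have := (dual_rep_mk_ne_zero_iff (c i) h).1 this
      simpa [hc, hi] using this
    -- The coordinates of `t` at variables lying in `I` act trivially and may be arbitrary.
    refine ⟨fun i => if h : X i ∈ I then 1 else Units.mk0 (a i) (ha i h), Subtype.ext ?_⟩
    rw [torusAction_torusBasePoint]
    refine mk_congr (congrArg _ (Finset.sum_congr rfl fun i _ => ?_)) _ _
    by_cases hi : (X i : MvPolynomial (Fin n) K) ∈ I
    · rw [Ideal.Quotient.eq_zero_iff_mem.2 hi, smul_zero, smul_zero]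
    · simp [hi]

end MonomialTorus

end SPair

end

theorem proposition3p5 {K : Type*} [Field K] [IsAlgClosed K] [CharZero K] (n : ℕ)
    (I : Ideal (MvPolynomial (Fin n) K)) (hI : SPair.IsMonomialIdeal I)
    [FiniteDimensional K (MvPolynomial (Fin n) K ⧸ I)]
    [IsLocalRing (MvPolynomial (Fin n) K ⧸ I)] :
    SPair.IsSPair (SPair.variableSpan I) ∧
    ∃ (ε : Multiplicative (SPair.variableSpan I) →*
          ((MvPolynomial (Fin n) K ⧸ I) ≃ₗ[K] (MvPolynomial (Fin n) K ⧸ I)))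
      (ρ : (Fin n → Kˣ) →*
          ((MvPolynomial (Fin n) K ⧸ I) ≃ₗ[K] (MvPolynomial (Fin n) K ⧸ I)))
      (a : Multiplicative (SPair.variableSpan I) →*
          Equiv.Perm (SPair.expVariety (SPair.variableSpan I)))
      (τ : (Fin n → Kˣ) →* Equiv.Perm (SPair.expVariety (SPair.variableSpan I))),
      -- the additive group acts on the algebra through multiplication by exponents
      (∀ (u : SPair.variableSpan I) (b : MvPolynomial (Fin n) K ⧸ I),
        ε (Multiplicative.ofAdd u) b =
          IsNilpotent.exp (u : MvPolynomial (Fin n) K ⧸ I) * b) ∧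
      -- this gives the induced additive action on the variety of the pair
      SPair.IsInducedAdditiveAction (SPair.projAction ε)
        (SPair.expVariety (SPair.variableSpan I)) ∧
      SPair.IsRestriction (SPair.projAction ε) (SPair.expVariety (SPair.variableSpan I)) a ∧
      SPair.IsAdditiveAction (SPair.expVariety (SPair.variableSpan I)) a ∧
      -- the torus acts by scaling monomials, regularly and with an open orbit
      (∀ (t : Fin n → Kˣ) (m : Fin n →₀ ℕ),
        ρ t (Ideal.Quotient.mk I (MvPolynomial.monomial m 1)) =
          (∏ i, (t i : K) ^ m i) • Ideal.Quotient.mk I (MvPolynomial.monomial m 1)) ∧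
      SPair.IsRestriction (SPair.projAction ρ) (SPair.expVariety (SPair.variableSpan I)) τ ∧
      SPair.IsRegularAction (SPair.torusFun K n)
        (SPair.expVariety (SPair.variableSpan I)) τ ∧
      SPair.HasOpenOrbit (SPair.expVariety (SPair.variableSpan I)) τ ∧
      ((∀ i, MvPolynomial.X i ∉ I) → Function.Injective τ) ∧
      -- the torus normalizes the additive group
      τ.range ≤ Subgroup.normalizer (a.range : Set (Equiv.Perm _)) := by
  obtain ⟨N, e, c, p, hN, hp, he, hpe, -⟩ := hI.exists_chart
  exact ⟨hI.isSPair,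
    SPair.expRepresentation (SPair.variableSpan I) fun _ hu => hI.isNilpotent_of_mem hu,
    SPair.torusRepresentation hI, SPair.additiveAction hI, SPair.torusAction hI,
    fun _ _ => rfl,
    SPair.isInducedAdditiveAction_exp _ hN he hpe,
    fun _ _ => rfl,
    SPair.isAdditiveAction_exp _ hN hp he hpe,
    fun t => SPair.scaleHom_mk_monomial hI _,
    fun _ _ => rfl,
    SPair.isRegularMap_projAction (SPair.torusRepresentation_hasCoordsIn hI) _,
    SPair.hasOpenOrbit_torusAction hI,
    SPair.torusAction_injective hI,
    SPair.torusAction_range_le_normalizer hI⟩
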